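/- Let $\overline{\mathbb D}=\{z\in\mathbb C : |z|\le 1\}$ be the closed unit disk. A Leja sequence for the unit disk is a sequence $(\eta_1,\eta_2,\ldots)$ of points of $\overline{\mathbb D}$ such that $|\eta_1|=1$ and, for every $k\ge 2$, $$\sup_{z\in\overline{\mathbb D}}\ \prod_{j=1}^{k-1}|z-\eta_j| \;=\; \prod_{j=1}^{k-1}|\eta_k-\eta_j|.$$ The points of such a sequence are pairwise distinct. For $N\ge k\ge 1$, let $$l_k^{(N)}(z)=\prod_{1\le j\le N,\ j\ne k}\frac{z-\eta_j}{\eta_k-\eta_j}$$ be the fundamental Lagrange interpolation polynomials of its first $N$ points. **Theorem.** For every Leja sequence for the unit disk, $$\sup_{N\ge k\ge 1}\ \sup_{z\in\overline{\mathbb D}}\ \bigl|l_k^{(N)}(z)\bigr| \;\le\; \pi\exp(3\pi).$$ -/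

import Mathlib

open Polynomial

/-- A Leja sequence for a compact set `K ⊆ ℂ`. Indices start at `0`, so that `η k` is the point
usually written `η_{k+1}`. All points lie in `K`, the first one lies on the boundary of `K`, and
for every `k ≥ 1` the supremum over `z ∈ K` of `∏_{j < k} |z - η j|` equals
`∏_{j < k} |η k - η j|`. -/
structure IsLejaSequence (K : Set ℂ) (η : ℕ → ℂ) : Prop where
  mem : ∀ k, η k ∈ K
  first_mem_boundary : η 0 ∈ frontier K
  isLUB : ∀ k, 1 ≤ k →
    IsLUB ((fun z : ℂ => ∏ j ∈ Finset.range k, ‖z - η j‖) '' K)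
      (∏ j ∈ Finset.range k, ‖η k - η j‖)

/-- The points of a Leja sequence for an infinite set are pairwise distinct, so that the
denominators of the fundamental Lagrange polynomials below never vanish. -/
theorem IsLejaSequence.injective {K : Set ℂ} {η : ℕ → ℂ} (h : IsLejaSequence K η)
    (hK : K.Infinite) : Function.Injective η := by
  suffices H : ∀ i k, i < k → η i ≠ η k by
    intro a b hab
    rcases lt_trichotomy a b with hlt | heq | hgt
    · exact absurd hab (H a b hlt)
    · exact heq
    · exact absurd hab.symm (H b a hgt)
  intro i k hik he
  apply hK
  refine ((Finset.range k).image η).finite_toSet.subset fun z hz => ?_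
  have h0 : ∏ j ∈ Finset.range k, ‖η k - η j‖ = 0 :=
    Finset.prod_eq_zero (Finset.mem_range.2 hik) (by simp [he])
  have h1 : ∏ j ∈ Finset.range k, ‖z - η j‖ ≤ 0 :=
    h0 ▸ (h.isLUB k (by omega)).1 ⟨z, hz, rfl⟩
  have h2 : ∏ j ∈ Finset.range k, ‖z - η j‖ = 0 :=
    le_antisymm h1 (Finset.prod_nonneg fun _ _ => norm_nonneg _)
  obtain ⟨j, hj, hj'⟩ := Finset.prod_eq_zero_iff.1 h2
  have : η j = z := (sub_eq_zero.1 (norm_eq_zero.1 hj')).symm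
  exact Finset.mem_coe.2 (Finset.mem_image.2 ⟨j, hj, this⟩)

/-- The fundamental Lagrange interpolation polynomial at the node `η k` (`k < N`) associated with
the `N`-section `(η 0, …, η (N - 1))`, namely
`z ↦ ∏_{j < N, j ≠ k} (z - η j) / (η k - η j)`. -/
noncomputable def fundamentalLagrange (η : ℕ → ℂ) (N k : ℕ) : ℂ[X] :=
  Lagrange.basis (Finset.range N) η k

/-! A Leja sequence for the disk is dyadic: within each block of `2 ^ (i + 1)` indices, the `2 ^
i`-th powers at the starts of the two halves are opposite. Hence ω(z) = ∏_{j<N} (z - η_j) factors as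
∏ (z ^ 2 ^ i + η_N ^ 2 ^ i) over the binary digits i of N equal to 1. Put x = z/η_N, y = η_k/η_N, δ
= |x - y|, and let p be the top digit where k and N differ, so y ^ 2 ^ p = -1. Since l_k(z) =
ω(z)/((z - η_k) ω'(η_k)), it suffices to compare ∏ |x ^ 2 ^ i + 1| with δ · 2 ^ p · ∏_{i≠p} |y ^ 2 ^
i + 1|; this is `prod_norm_pow_add_one_le`. Digits above p only help, as y ^ 2 ^ i = 1 there. Below
p the ratios are governed by c_J = δ 2 ^ J / |y ^ 2 ^ J - 1|: while c_J ≤ 1 their product is at most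
e², and afterwards it grows no faster than c_J. The resulting bound 2e² is well below π exp(3π). -/

/-! ### Estimates for products of binary factors -/

theorem norm_sq_sub_one (y : ℂ) (i : ℕ) :
    ‖y ^ 2 ^ (i + 1) - 1‖ = ‖y ^ 2 ^ i - 1‖ * ‖y ^ 2 ^ i + 1‖ := by
  rw [← norm_mul]
  congr 1
  ring

theorem pow_two_pow_ne_one_of_succ {y : ℂ} {i : ℕ} (h : y ^ 2 ^ (i + 1) ≠ 1) :
    y ^ 2 ^ i ≠ 1 := fun h' => h (by rw [pow_succ, pow_mul, h', one_pow])

theorem norm_pow_sub_one_pos_and {y : ℂ} {i : ℕ} (h : y ^ 2 ^ (i + 1) ≠ 1) :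
    0 < ‖y ^ 2 ^ i - 1‖ ∧ 0 < ‖y ^ 2 ^ i + 1‖ := by
  have h1 : ‖y ^ 2 ^ (i + 1) - 1‖ ≠ 0 := norm_ne_zero_iff.2 (sub_ne_zero.2 h)
  rw [norm_sq_sub_one] at h1
  exact ⟨(norm_nonneg _).lt_of_ne' (left_ne_zero_of_mul h1),
    (norm_nonneg _).lt_of_ne' (right_ne_zero_of_mul h1)⟩

theorem norm_pow_sub_one_le_two {y : ℂ} (hy : ‖y‖ ≤ 1) (m : ℕ) : ‖y ^ m - 1‖ ≤ 2 := by
  have h1 : ‖y ^ m‖ ≤ 1 := by rw [norm_pow]; exact pow_le_one₀ (norm_nonneg _) hy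
  have h2 := norm_sub_le (y ^ m) 1
  rw [norm_one] at h2
  linarith

theorem norm_pow_add_one_le_two {y : ℂ} (hy : ‖y‖ ≤ 1) (m : ℕ) : ‖y ^ m + 1‖ ≤ 2 := by
  have h1 : ‖y ^ m‖ ≤ 1 := by rw [norm_pow]; exact pow_le_one₀ (norm_nonneg _) hy
  have h2 := norm_add_le (y ^ m) 1
  rw [norm_one] at h2
  linarith

theorem norm_pow_sub_pow_le {x y : ℂ} (hx : ‖x‖ ≤ 1) (hy : ‖y‖ ≤ 1) (m : ℕ) :
    ‖x ^ m - y ^ m‖ ≤ m * ‖x - y‖ := by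
  induction m with
  | zero => simp
  | succ m ih =>
    have h : x ^ (m + 1) - y ^ (m + 1) = x ^ m * (x - y) + (x ^ m - y ^ m) * y := by ring
    have h1 : ‖x ^ m‖ ≤ 1 := by rw [norm_pow]; exact pow_le_one₀ (norm_nonneg _) hx
    calc ‖x ^ (m + 1) - y ^ (m + 1)‖ ≤ ‖x ^ m‖ * ‖x - y‖ + ‖x ^ m - y ^ m‖ * ‖y‖ := by
          rw [h, ← norm_mul, ← norm_mul]; exact norm_add_le _ _
      _ ≤ 1 * ‖x - y‖ + (m * ‖x - y‖) * 1 := by gcongr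
      _ = ((m + 1 : ℕ) : ℝ) * ‖x - y‖ := by push_cast; ring

/-- Factoring y ^ 2 ^ (J + 1) - 1 makes the bound inductive; the summand 1/2 leaves the slack (2 -
a)(2 - b)/(2ab), nonnegative since both factors have norm at most 2. -/
theorem sum_two_pow_div_norm_le {y : ℂ} (hy : ‖y‖ ≤ 1) (J : ℕ) (h : y ^ 2 ^ J ≠ 1) :
    ∑ i ∈ Finset.range J, (2 : ℝ) ^ i / ‖y ^ 2 ^ i + 1‖
      ≤ 2 ^ J * (1 / ‖y ^ 2 ^ J - 1‖ + 1 / 2) := by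
  induction J with
  | zero => simp only [Finset.range_zero, Finset.sum_empty]; positivity
  | succ J ih =>
    obtain ⟨ha, hb⟩ := norm_pow_sub_one_pos_and h
    have ha2 := norm_pow_sub_one_le_two hy (2 ^ J)
    have hb2 := norm_pow_add_one_le_two hy (2 ^ J)
    have ih := ih (pow_two_pow_ne_one_of_succ h)
    rw [Finset.sum_range_succ, norm_sq_sub_one]
    generalize ‖y ^ 2 ^ J - 1‖ = a at *
    generalize ‖y ^ 2 ^ J + 1‖ = b at *
    have key : 1 / a + 1 / 2 + 1 / b ≤ 2 * (1 / (a * b) + 1 / 2) := by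
      rw [← sub_nonneg]
      have : 2 * (1 / (a * b) + 1 / 2) - (1 / a + 1 / 2 + 1 / b)
          = (2 - a) * (2 - b) / (2 * (a * b)) := by field_simp; ring
      rw [this]
      exact div_nonneg (mul_nonneg (by linarith) (by linarith)) (by positivity)
    calc _ ≤ (2 : ℝ) ^ J * (1 / a + 1 / 2) + 2 ^ J / b := by gcongr
      _ = 2 ^ J * (1 / a + 1 / 2 + 1 / b) := by ring
      _ ≤ 2 ^ J * (2 * (1 / (a * b) + 1 / 2)) := by gcongr
      _ = _ := by ring

/-- An upper bound for `‖x ^ 2 ^ i + 1‖ / ‖y ^ 2 ^ i + 1‖` when `x`, `y` lie in the unit disk at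
distance `δ`. -/
noncomputable def ratioBound (y : ℂ) (δ : ℝ) (i : ℕ) : ℝ :=
  min (2 / ‖y ^ 2 ^ i + 1‖) (1 + 2 ^ i * δ / ‖y ^ 2 ^ i + 1‖)

theorem ratioBound_nonneg (y : ℂ) {δ : ℝ} (hδ : 0 ≤ δ) (i : ℕ) : 0 ≤ ratioBound y δ i :=
  le_min (by positivity) (by positivity)

theorem prod_ratioBound_le_exp {y : ℂ} (hy : ‖y‖ ≤ 1) {δ : ℝ} (hδ : 0 ≤ δ) (J : ℕ)
    (h : y ^ 2 ^ J ≠ 1) (hJ : δ * (2 ^ J / ‖y ^ 2 ^ J - 1‖) ≤ 1) :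
    ∏ i ∈ Finset.range J, ratioBound y δ i ≤ Real.exp 2 := by
  have hpos : 0 < ‖y ^ 2 ^ J - 1‖ := norm_pos_iff.2 (sub_ne_zero.2 h)
  have h2 := norm_pow_sub_one_le_two hy (2 ^ J)
  calc ∏ i ∈ Finset.range J, ratioBound y δ i
      ≤ ∏ i ∈ Finset.range J, Real.exp (δ * (2 ^ i / ‖y ^ 2 ^ i + 1‖)) := by
        refine Finset.prod_le_prod (fun i _ => ratioBound_nonneg y hδ i) fun i _ => ?_
        refine (min_le_right _ _).trans ?_
        have := Real.add_one_le_exp (δ * (2 ^ i / ‖y ^ 2 ^ i + 1‖))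
        calc _ = δ * (2 ^ i / ‖y ^ 2 ^ i + 1‖) + 1 := by ring
          _ ≤ _ := this
    _ = Real.exp (δ * ∑ i ∈ Finset.range J, 2 ^ i / ‖y ^ 2 ^ i + 1‖) := by
        rw [← Real.exp_sum, Finset.mul_sum]
    _ ≤ Real.exp 2 := by
        refine Real.exp_le_exp.2 ?_
        calc _ ≤ δ * (2 ^ J * (1 / ‖y ^ 2 ^ J - 1‖ + 1 / 2)) := by
              gcongr; exact sum_two_pow_div_norm_le hy J h
          _ ≤ δ * (2 ^ J * (1 / ‖y ^ 2 ^ J - 1‖ + 1 / ‖y ^ 2 ^ J - 1‖)) := by gcongr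
          _ = 2 * (δ * (2 ^ J / ‖y ^ 2 ^ J - 1‖)) := by ring
          _ ≤ 2 := by linarith

/-- The quantity c_J = δ 2 ^ J / |y ^ 2 ^ J - 1| is multiplied at each step by exactly 2 / |y ^ 2 ^
J + 1|, the first term of the minimum in `ratioBound`. -/
theorem prod_ratioBound_le {y : ℂ} (hy : ‖y‖ ≤ 1) {δ : ℝ} (hδ : 0 ≤ δ) (J : ℕ)
    (h : y ^ 2 ^ J ≠ 1) :
    ∏ i ∈ Finset.range J, ratioBound y δ i
      ≤ 2 * Real.exp 2 * max 1 (δ * (2 ^ J / ‖y ^ 2 ^ J - 1‖)) := by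
  have hE : 1 ≤ Real.exp 2 := Real.one_le_exp (by norm_num)
  have small : ∀ J : ℕ, y ^ 2 ^ J ≠ 1 → δ * (2 ^ J / ‖y ^ 2 ^ J - 1‖) ≤ 1 →
      ∏ i ∈ Finset.range J, ratioBound y δ i
        ≤ 2 * Real.exp 2 * max 1 (δ * (2 ^ J / ‖y ^ 2 ^ J - 1‖)) := fun J h hJ => by
    rw [max_eq_left hJ]
    linarith [prod_ratioBound_le_exp hy hδ J h hJ]
  induction J with
  | zero =>
    have := le_max_left 1 (δ * (2 ^ 0 / ‖y ^ 2 ^ 0 - 1‖))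
    rw [Finset.range_zero, Finset.prod_empty]
    nlinarith
  | succ J ih =>
    rcases le_total (δ * (2 ^ (J + 1) / ‖y ^ 2 ^ (J + 1) - 1‖)) 1 with hJ | hJ
    · exact small _ h hJ
    obtain ⟨ha, hb⟩ := norm_pow_sub_one_pos_and h
    have h' := pow_two_pow_ne_one_of_succ h
    have ha2 := norm_pow_sub_one_le_two hy (2 ^ J)
    have ih := ih h'
    rw [max_eq_right hJ, Finset.prod_range_succ]
    have hP : 0 ≤ ∏ i ∈ Finset.range J, ratioBound y δ i :=
      Finset.prod_nonneg fun i _ => ratioBound_nonneg y hδ i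
    -- If c_J crosses 1 at this step, the new factor is at most 1 + c_{J+1} ≤ 2 c_{J+1}: the source
    -- of the 2 in 2e².
    rcases le_total (δ * (2 ^ J / ‖y ^ 2 ^ J - 1‖)) 1 with hJ' | hJ'
    · have h1 := prod_ratioBound_le_exp hy hδ J h' hJ'
      have h2 : ratioBound y δ J ≤ 2 * (δ * (2 ^ (J + 1) / ‖y ^ 2 ^ (J + 1) - 1‖)) := by
        refine (min_le_right _ _).trans ?_
        have : 2 ^ J * δ / ‖y ^ 2 ^ J + 1‖ ≤ δ * (2 ^ (J + 1) / ‖y ^ 2 ^ (J + 1) - 1‖) := by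
          rw [norm_sq_sub_one]
          generalize ‖y ^ 2 ^ J - 1‖ = a at *
          generalize ‖y ^ 2 ^ J + 1‖ = b at *
          calc 2 ^ J * δ / b = δ * (2 ^ J * a / (a * b)) := by field_simp
            _ ≤ δ * (2 ^ J * 2 / (a * b)) := by gcongr
            _ = _ := by ring
        linarith
      calc _ ≤ Real.exp 2 * (2 * (δ * (2 ^ (J + 1) / ‖y ^ 2 ^ (J + 1) - 1‖))) :=
            mul_le_mul h1 h2 (ratioBound_nonneg y hδ J) (by positivity)
        _ = _ := by ring
    · rw [max_eq_right hJ'] at ih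
      calc _ ≤ 2 * Real.exp 2 * (δ * (2 ^ J / ‖y ^ 2 ^ J - 1‖)) * (2 / ‖y ^ 2 ^ J + 1‖) :=
            mul_le_mul ih (min_le_left _ _) (ratioBound_nonneg y hδ J) (by positivity)
        _ = _ := by rw [norm_sq_sub_one]; field_simp; ring

theorem one_le_ratioBound {y : ℂ} (hy : ‖y‖ ≤ 1) {δ : ℝ} (hδ : 0 ≤ δ) {i : ℕ}
    (h : 0 < ‖y ^ 2 ^ i + 1‖) : 1 ≤ ratioBound y δ i := by
  refine le_min ?_ ?_
  · rw [le_div_iff₀ h]; linarith [norm_pow_add_one_le_two hy (2 ^ i)]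
  · have : 0 ≤ 2 ^ i * δ / ‖y ^ 2 ^ i + 1‖ := by positivity
    linarith

theorem norm_pow_add_one_le_ratioBound_mul {x y : ℂ} (hx : ‖x‖ ≤ 1) (hy : ‖y‖ ≤ 1) {i : ℕ}
    (h : 0 < ‖y ^ 2 ^ i + 1‖) :
    ‖x ^ 2 ^ i + 1‖ ≤ ratioBound y ‖x - y‖ i * ‖y ^ 2 ^ i + 1‖ := by
  rw [← div_le_iff₀ h]
  refine le_min ?_ ?_
  · have := norm_pow_add_one_le_two hx (2 ^ i); gcongr
  · have h1 := norm_pow_sub_pow_le hx hy (2 ^ i)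
    have h2 : ‖x ^ 2 ^ i + 1‖ ≤ ‖x ^ 2 ^ i - y ^ 2 ^ i‖ + ‖y ^ 2 ^ i + 1‖ := by
      refine le_trans (le_of_eq ?_) (norm_add_le _ _); congr 1; ring
    rw [div_le_iff₀ h, add_mul, div_mul_cancel₀ _ h.ne']
    push_cast at h1
    linarith

theorem norm_pow_add_one_pos_of_pow_eq_neg_one {y : ℂ} {p : ℕ} (hp : y ^ 2 ^ p = -1) {i : ℕ}
    (hi : i < p) : 0 < ‖y ^ 2 ^ i + 1‖ := by
  refine norm_pos_iff.2 fun h0 => ?_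
  have h1 : y ^ 2 ^ i = -1 := eq_neg_of_add_eq_zero_left h0
  obtain ⟨d, rfl⟩ := Nat.exists_eq_add_of_lt hi
  rw [add_assoc, pow_add, pow_mul, h1, pow_succ', pow_mul] at hp
  norm_num at hp

/-- Comparison of two products of binary factors at `x` and at `y`, where `y ^ 2 ^ p = -1`. The
set `B` is the set of exponents that occur, and the factor with exponent `2 ^ p`, which vanishes
at `y`, is replaced by its derivative there. -/
theorem prod_norm_pow_add_one_le {x y : ℂ} (hx : ‖x‖ ≤ 1) (hy : ‖y‖ ≤ 1) {p : ℕ}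
    (hp : y ^ 2 ^ p = -1) {B : Finset ℕ} (hpB : p ∈ B) :
    ∏ i ∈ B, ‖x ^ 2 ^ i + 1‖
      ≤ 2 * Real.exp 2 * (‖x - y‖ * (2 ^ p * ∏ i ∈ B.erase p, ‖y ^ 2 ^ i + 1‖)) := by
  set δ := ‖x - y‖ with hδ_def
  have hδ : 0 ≤ δ := norm_nonneg _
  have hhigh : ∀ i, p < i → y ^ 2 ^ i = 1 := by
    intro i hi
    obtain ⟨d, rfl⟩ := Nat.exists_eq_add_of_lt hi
    rw [add_assoc, pow_add, pow_mul, hp, pow_succ', pow_mul]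
    norm_num
  have hpt : ∀ i ∈ B.erase p, ‖x ^ 2 ^ i + 1‖
      ≤ (if i ∈ Finset.range p then ratioBound y δ i else 1) * ‖y ^ 2 ^ i + 1‖ := by
    intro i hi
    have hne := Finset.ne_of_mem_erase hi
    split_ifs with hip
    · exact norm_pow_add_one_le_ratioBound_mul hx hy
        (norm_pow_add_one_pos_of_pow_eq_neg_one hp (Finset.mem_range.1 hip))
    · rw [Finset.mem_range] at hip
      rw [hhigh i (by omega)]
      have := norm_pow_add_one_le_two hx (2 ^ i)
      norm_num
      exact this
  have hratio : ∏ i ∈ B.erase p, (if i ∈ Finset.range p then ratioBound y δ i else 1)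
      ≤ ∏ i ∈ Finset.range p, ratioBound y δ i := by
    rw [Finset.prod_ite_mem]
    exact Finset.prod_le_prod_of_subset_of_one_le Finset.inter_subset_right
      (fun i _ => ratioBound_nonneg y hδ i) fun i hi _ => one_le_ratioBound hy hδ
        (norm_pow_add_one_pos_of_pow_eq_neg_one hp (Finset.mem_range.1 hi))
  have hmain := prod_ratioBound_le hy hδ p (by rw [hp]; norm_num)
  have htop : ‖x ^ 2 ^ p + 1‖ ≤ 2 ^ p * δ := by
    have := norm_pow_sub_pow_le hx hy (2 ^ p)
    rw [hp, sub_neg_eq_add] at this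
    exact_mod_cast this
  have htop2 := norm_pow_add_one_le_two hx (2 ^ p)
  have hnorm : ‖y ^ 2 ^ p - 1‖ = 2 := by rw [hp]; norm_num
  rw [hnorm] at hmain
  have hcomb : ‖x ^ 2 ^ p + 1‖ * ∏ i ∈ Finset.range p, ratioBound y δ i
      ≤ 2 * Real.exp 2 * (2 ^ p * δ) := by
    calc _ ≤ ‖x ^ 2 ^ p + 1‖ * (2 * Real.exp 2 * max 1 (δ * (2 ^ p / 2))) := by gcongr
      _ = 2 * Real.exp 2 * (‖x ^ 2 ^ p + 1‖ * max 1 (δ * (2 ^ p / 2))) := by ring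
      _ ≤ 2 * Real.exp 2 * (2 ^ p * δ) := by
        refine mul_le_mul_of_nonneg_left ?_ (by positivity)
        -- The factor at p is at most both 2 ^ p δ and 2; each bound suits one value of the maximum.
        rcases max_cases 1 (δ * (2 ^ p / 2)) with ⟨h, _⟩ | ⟨h, h'⟩
        · rw [h]; linarith
        · rw [h]
          calc _ ≤ 2 * (δ * (2 ^ p / 2)) := by gcongr
            _ = _ := by ring
  rw [← Finset.mul_prod_erase B _ hpB]
  calc _ ≤ ‖x ^ 2 ^ p + 1‖ * ∏ i ∈ B.erase p,
          ((if i ∈ Finset.range p then ratioBound y δ i else 1) * ‖y ^ 2 ^ i + 1‖) := by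
        gcongr with i hi
        exact hpt i hi
    _ ≤ ‖x ^ 2 ^ p + 1‖ * ((∏ i ∈ Finset.range p, ratioBound y δ i) *
          ∏ i ∈ B.erase p, ‖y ^ 2 ^ i + 1‖) := by
        rw [Finset.prod_mul_distrib]
        gcongr
    _ = (‖x ^ 2 ^ p + 1‖ * ∏ i ∈ Finset.range p, ratioBound y δ i) *
          ∏ i ∈ B.erase p, ‖y ^ 2 ^ i + 1‖ := by ring
    _ ≤ 2 * Real.exp 2 * (2 ^ p * δ) * ∏ i ∈ B.erase p, ‖y ^ 2 ^ i + 1‖ := by gcongr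
    _ = _ := by ring

/-! ### Dyadic structure of Leja sequences -/

/-- The terms of `η` with index at most `n` satisfy the relations
`η ((2 a + 1) 2 ^ i) ^ 2 ^ i = -η (2 a 2 ^ i) ^ 2 ^ i` that characterize Leja sequences for the
unit disk. -/
def DyadicAlternating (η : ℕ → ℂ) (n : ℕ) : Prop :=
  ∀ a i, (2 * a + 1) * 2 ^ i ≤ n → η ((2 * a + 1) * 2 ^ i) ^ 2 ^ i = -η (2 * a * 2 ^ i) ^ 2 ^ i

theorem DyadicAlternating.mono {η : ℕ → ℂ} {m n : ℕ} (h : DyadicAlternating η n) (hmn : m ≤ n) :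
    DyadicAlternating η m := fun a i hi => h a i (hi.trans hmn)

/-- Clearing digit i of the index only flips the sign of the `2 ^ i`-th power, and the next squaring
removes that sign. -/
theorem DyadicAlternating.pow_eq {η : ℕ → ℂ} {n : ℕ} (h : DyadicAlternating η n) (i : ℕ) :
    η n ^ 2 ^ i = η (n / 2 ^ i * 2 ^ i) ^ 2 ^ i := by
  induction i with
  | zero => simp
  | succ i ih =>
    have hdiv : n / 2 ^ (i + 1) = n / 2 ^ i / 2 := by rw [pow_succ, Nat.div_div_eq_div_mul]
    have hle : n / 2 ^ i * 2 ^ i ≤ n := Nat.div_mul_le_self _ _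
    rw [pow_succ 2 i, pow_mul, ih, ← pow_mul, ← pow_succ, hdiv]
    rcases Nat.even_or_odd' (n / 2 ^ i) with ⟨a, ha | ha⟩
    · rw [ha, Nat.mul_div_cancel_left a two_pos, pow_succ 2 i]
      congr 2
      ring
    · rw [ha] at hle ⊢
      rw [show (2 * a + 1) / 2 = a by omega, pow_succ 2 i, pow_mul, h a i hle, neg_sq, ← pow_mul]
      congr 2
      ring

theorem DyadicAlternating.norm_eq_one {η : ℕ → ℂ} {n : ℕ} (h : DyadicAlternating η n)
    (h0 : ‖η 0‖ = 1) : ‖η n‖ = 1 := by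
  induction n using Nat.strong_induction_on with
  | _ n ih =>
    rcases Nat.eq_zero_or_pos n with rfl | hn
    · exact h0
    obtain ⟨i, m, ⟨a, rfl⟩, rfl⟩ := Nat.exists_eq_two_pow_mul_odd hn.ne'
    rw [mul_comm] at h ih ⊢
    have hlt : 2 * a * 2 ^ i < (2 * a + 1) * 2 ^ i := by gcongr; omega
    have h1 := congrArg norm (h a i le_rfl)
    rw [norm_neg, norm_pow, norm_pow, ih _ hlt (h.mono hlt.le), one_pow] at h1
    exact (pow_eq_one_iff_of_nonneg (norm_nonneg _) (by positivity)).1 h1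

theorem DyadicAlternating.prod_block {η : ℕ → ℂ} (i a : ℕ)
    (h : ∀ m < (a + 1) * 2 ^ i, DyadicAlternating η m) :
    ∏ j ∈ Finset.range (2 ^ i), (X - C (η (a * 2 ^ i + j)))
      = X ^ 2 ^ i - C (η (a * 2 ^ i) ^ 2 ^ i) := by
  induction i generalizing a with
  | zero => simp
  | succ i ih =>
    have e : (a + 1) * 2 ^ (i + 1) = (2 * a + 2) * 2 ^ i := by ring
    have h1 := ih (2 * a) fun m hm => h m (hm.trans_le (by rw [e]; gcongr; omega))
    have h2 := ih (2 * a + 1) fun m hm => h m (by rw [e]; exact hm)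
    have h3 := h ((2 * a + 1) * 2 ^ i) (by rw [e]; gcongr; omega) a i le_rfl
    have e1 : a * 2 ^ (i + 1) = 2 * a * 2 ^ i := by ring
    rw [pow_succ 2 i, mul_two, Finset.prod_range_add, ← mul_two, ← pow_succ, e1, h1]
    have e2 : ∀ j, 2 * a * 2 ^ i + (2 ^ i + j) = (2 * a + 1) * 2 ^ i + j := fun j => by ring
    simp only [e2]
    rw [h2, h3, C_neg, pow_succ 2 i, pow_mul, pow_mul, C_pow]
    simp only [C_pow]
    ring

theorem DyadicAlternating.prod_range_mul {η : ℕ → ℂ} (i a : ℕ)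
    (h : ∀ m < a * 2 ^ i, DyadicAlternating η m) :
    ∏ j ∈ Finset.range (a * 2 ^ i), (X - C (η j))
      = ∏ b ∈ Finset.range a, (X ^ 2 ^ i - C (η (b * 2 ^ i) ^ 2 ^ i)) := by
  induction a with
  | zero => simp
  | succ a ih =>
    rw [Finset.prod_range_succ, ← prod_block i a h, add_mul, one_mul, Finset.prod_range_add,
      ih fun m hm => h m (hm.trans_le (by gcongr; omega))]

theorem eq_neg_of_two_le_norm_sub {u v : ℂ} (hu : ‖u‖ ≤ 1) (hv : ‖v‖ = 1) (h : 2 ≤ ‖u - v‖) :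
    u = -v := by
  have hp := parallelogram_law_with_norm ℝ u v
  have h0 : ‖u + v‖ = 0 := by
    have := norm_nonneg u
    have := norm_nonneg (u + v)
    nlinarith
  exact eq_neg_of_add_eq_zero_left (norm_eq_zero.1 h0)

theorem IsLejaSequence.prod_le {K : Set ℂ} {η : ℕ → ℂ} (h : IsLejaSequence K η) (k : ℕ) {z : ℂ}
    (hz : z ∈ K) :
    ∏ j ∈ Finset.range k, ‖z - η j‖ ≤ ∏ j ∈ Finset.range k, ‖η k - η j‖ := by
  rcases Nat.eq_zero_or_pos k with rfl | hk
  · simp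
  · exact (h.isLUB k hk).1 ⟨z, hz, rfl⟩

theorem infinite_closedBall_zero_one : (Metric.closedBall (0 : ℂ) 1).Infinite :=
  infinite_of_mem_nhds 0 (Metric.closedBall_mem_nhds 0 one_pos)

theorem IsLejaSequence.norm_zero_eq_one {η : ℕ → ℂ}
    (h : IsLejaSequence (Metric.closedBall (0 : ℂ) 1) η) : ‖η 0‖ = 1 := by
  have h0 := h.first_mem_boundary
  rw [frontier_closedBall _ one_ne_zero] at h0
  exact mem_sphere_zero_iff_norm.1 h0

theorem IsLejaSequence.dyadicAlternating {η : ℕ → ℂ}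
    (h : IsLejaSequence (Metric.closedBall (0 : ℂ) 1) η) (n : ℕ) : DyadicAlternating η n := by
  induction n using Nat.strong_induction_on with
  | _ n ih =>
    intro a i hn
    rcases hn.lt_or_eq with hlt | rfl
    · exact ih _ hlt a i le_rfl
    set n := (2 * a + 1) * 2 ^ i with hn_def
    set m := 2 * a * 2 ^ i with hm_def
    have hnm : n = m + 2 ^ i := by rw [hn_def, hm_def]; ring
    have hmn : m < n := by rw [hnm]; exact Nat.lt_add_of_pos_right (by positivity)
    have hm1 : m = a * 2 ^ (i + 1) := by rw [hm_def]; ring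
    have hηm : ‖η m‖ = 1 := (ih m hmn).norm_eq_one h.norm_zero_eq_one
    have hpre : ∏ j ∈ Finset.range m, (X - C (η j))
        = ∏ b ∈ Finset.range a, (X ^ 2 ^ (i + 1) - C (η (b * 2 ^ (i + 1)) ^ 2 ^ (i + 1))) := by
      rw [hm1]
      exact DyadicAlternating.prod_range_mul (i + 1) a fun l hl => ih l (by omega)
    have hblock := DyadicAlternating.prod_block (η := η) i (2 * a) fun l hl => ih l hl
    have hsplit : ∀ z : ℂ, ∏ j ∈ Finset.range n, ‖z - η j‖
        = (∏ j ∈ Finset.range m, ‖z - η j‖) * ‖z ^ 2 ^ i - η m ^ 2 ^ i‖ := by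
      intro z
      have := congrArg (fun q : ℂ[X] => ‖q.eval z‖) hblock
      simp only [eval_prod, eval_sub, eval_X, eval_C, eval_pow, norm_prod] at this
      rw [hnm, Finset.prod_range_add, this]
    have hpos : 0 < ∏ j ∈ Finset.range m, ‖η m - η j‖ := by
      refine Finset.prod_pos fun j hj => norm_pos_iff.2 (sub_ne_zero.2 fun he => ?_)
      exact (Finset.mem_range.1 hj).ne' (h.injective infinite_closedBall_zero_one he)
    -- The product before m depends only on z ^ 2 ^ (i + 1), so w attains its maximum, as η m does,
    -- and also makes the last block maximal, of norm 2. Hence `η n` must make that block maximal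
    -- too.
    obtain ⟨w, hw⟩ := IsAlgClosed.exists_pow_nat_eq (-η m ^ 2 ^ i) (n := 2 ^ i) (by positivity)
    have hwn : ‖w‖ = 1 := by
      have := congrArg norm hw
      rw [norm_neg, norm_pow, norm_pow, hηm, one_pow] at this
      exact (pow_eq_one_iff_of_nonneg (norm_nonneg _) (by positivity)).1 this
    have hwm : ∏ j ∈ Finset.range m, ‖w - η j‖ = ∏ j ∈ Finset.range m, ‖η m - η j‖ := by
      have hw2 : w ^ 2 ^ (i + 1) = η m ^ 2 ^ (i + 1) := by
        rw [pow_succ 2 i, pow_mul, hw, neg_sq, ← pow_mul]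
      have h1 := congrArg (fun q : ℂ[X] => ‖q.eval w‖) hpre
      have h2 := congrArg (fun q : ℂ[X] => ‖q.eval (η m)‖) hpre
      simp only [eval_prod, eval_sub, eval_X, eval_C, eval_pow, norm_prod] at h1 h2
      rw [h1, h2, hw2]
    have hle := h.prod_le n (mem_closedBall_zero_iff.2 hwn.le)
    have hle' := h.prod_le m (h.mem n)
    rw [hsplit, hsplit, hwm, hw] at hle
    have hnorm2 : ‖-η m ^ 2 ^ i - η m ^ 2 ^ i‖ = 2 := by
      rw [← neg_add', norm_neg, ← two_mul, norm_mul, norm_pow, hηm]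
      norm_num
    rw [hnorm2] at hle
    refine eq_neg_of_two_le_norm_sub ?_ (by rw [norm_pow, hηm, one_pow]) ?_
    · rw [norm_pow]
      exact pow_le_one₀ (norm_nonneg _) (mem_closedBall_zero_iff.1 (h.mem n))
    · exact le_of_mul_le_mul_left (hle.trans (by gcongr)) hpos

/-! ### Binary factorization of the nodal polynomial and conclusion -/

/-- The positions of the binary digits of `n` equal to `1`. -/
def binaryDigitPositions (n : ℕ) : Finset ℕ :=
  (Finset.range n).filter fun i => n / 2 ^ i % 2 = 1

theorem nodal_eq_prod_binaryDigitPositions {η : ℕ → ℂ} {n : ℕ}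
    (h : ∀ m, DyadicAlternating η m) :
    Lagrange.nodal (Finset.range n) η
      = ∏ i ∈ binaryDigitPositions n, (X ^ 2 ^ i + C (η n ^ 2 ^ i)) := by
  -- Peel off blocks from the lowest digit up; at l = n no initial segment remains.
  have key : ∀ l, Lagrange.nodal (Finset.range n) η
      = (∏ j ∈ Finset.range (n / 2 ^ l * 2 ^ l), (X - C (η j))) *
        ∏ i ∈ Finset.range l, if n / 2 ^ i % 2 = 1 then X ^ 2 ^ i + C (η n ^ 2 ^ i) else 1 := by
    intro l
    induction l with
    | zero => simp [Lagrange.nodal]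
    | succ l ih =>
      have hdiv : n / 2 ^ (l + 1) = n / 2 ^ l / 2 := by rw [pow_succ, Nat.div_div_eq_div_mul]
      rw [ih, Finset.prod_range_succ, (h n).pow_eq l, hdiv]
      rcases Nat.even_or_odd' (n / 2 ^ l) with ⟨a, ha | ha⟩
      · rw [ha, if_neg (by omega), mul_one, Nat.mul_div_cancel_left a two_pos,
          show a * 2 ^ (l + 1) = 2 * a * 2 ^ l by ring]
      · rw [ha, if_pos (by omega), show (2 * a + 1) / 2 = a by omega, h _ a l le_rfl, C_neg,
          ← sub_eq_add_neg, ← DyadicAlternating.prod_block l (2 * a) fun m _ => h m,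
          show (2 * a + 1) * 2 ^ l = 2 * a * 2 ^ l + 2 ^ l by ring, Finset.prod_range_add,
          show a * 2 ^ (l + 1) = 2 * a * 2 ^ l by ring]
        ring
  rw [key n, Nat.div_eq_of_lt Nat.lt_two_pow_self, zero_mul, Finset.range_zero,
    Finset.prod_empty, one_mul, binaryDigitPositions, Finset.prod_filter]

theorem exists_top_differing_digit {k n : ℕ} (hkn : k < n) :
    ∃ p a, k / 2 ^ p = 2 * a ∧ n / 2 ^ p = 2 * a + 1 := by
  have hex : ∃ p, k / 2 ^ (p + 1) = n / 2 ^ (p + 1) :=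
    ⟨n, by rw [Nat.div_eq_of_lt, Nat.div_eq_of_lt] <;>
      have := Nat.lt_two_pow_self (n := n + 1) <;> omega⟩
  classical
  have hp := Nat.find_spec hex
  have hne : k / 2 ^ Nat.find hex ≠ n / 2 ^ Nat.find hex := by
    rcases Nat.eq_zero_or_pos (Nat.find hex) with h0 | h0
    · rw [h0]; simpa using hkn.ne
    · obtain ⟨q, hq⟩ := Nat.exists_eq_succ_of_ne_zero h0.ne'
      rw [hq]
      exact Nat.find_min hex (by omega)
  have hle : k / 2 ^ Nat.find hex ≤ n / 2 ^ Nat.find hex := Nat.div_le_div_right hkn.le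
  rw [pow_succ, ← Nat.div_div_eq_div_mul, ← Nat.div_div_eq_div_mul] at hp
  exact ⟨Nat.find hex, k / 2 ^ Nat.find hex / 2, by omega, by omega⟩

theorem norm_pow_add_pow_eq {z e : ℂ} (he : ‖e‖ = 1) (m : ℕ) :
    ‖z ^ m + e ^ m‖ = ‖(z / e) ^ m + 1‖ := by
  have he0 : e ≠ 0 := norm_ne_zero_iff.1 (by rw [he]; exact one_ne_zero)
  have : z ^ m + e ^ m = e ^ m * ((z / e) ^ m + 1) := by
    rw [div_pow, mul_add, mul_one, mul_div_cancel₀ _ (pow_ne_zero _ he0)]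
  rw [this, norm_mul, norm_pow, he, one_pow, one_mul]

theorem IsLejaSequence.prod_norm_sub_le {η : ℕ → ℂ}
    (h : IsLejaSequence (Metric.closedBall (0 : ℂ) 1) η) {N k : ℕ} (hk : k < N) {z : ℂ}
    (hz : ‖z‖ ≤ 1) :
    ∏ j ∈ Finset.range N, ‖z - η j‖
      ≤ 2 * Real.exp 2 * (‖z - η k‖ * ∏ j ∈ (Finset.range N).erase k, ‖η k - η j‖) := by
  have hD := h.dyadicAlternating
  have hone : ∀ j, ‖η j‖ = 1 := fun j => (hD j).norm_eq_one h.norm_zero_eq_one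
  have he0 : η N ≠ 0 := norm_ne_zero_iff.1 (by rw [hone]; exact one_ne_zero)
  obtain ⟨p, a, hka, hNa⟩ := exists_top_differing_digit hk
  have hkp : η k ^ 2 ^ p = -η N ^ 2 ^ p := by
    rw [(hD k).pow_eq p, (hD N).pow_eq p, hka, hNa, hD _ a p le_rfl, neg_neg]
  have hpB : p ∈ binaryDigitPositions N := by
    refine Finset.mem_filter.2 ⟨Finset.mem_range.2 ?_, by omega⟩
    by_contra hle
    rw [Nat.div_eq_of_lt ((Nat.lt_two_pow_self).trans_le
      (Nat.pow_le_pow_right two_pos (not_lt.1 hle)))] at hNa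
    omega
  have hnodal := nodal_eq_prod_binaryDigitPositions (n := N) hD
  have hz' : ∏ j ∈ Finset.range N, ‖z - η j‖
      = ∏ i ∈ binaryDigitPositions N, ‖(z / η N) ^ 2 ^ i + 1‖ := by
    have := congrArg (fun q : ℂ[X] => ‖q.eval z‖) hnodal
    simpa only [Lagrange.eval_nodal, eval_prod, eval_add, eval_X, eval_C, eval_pow, norm_prod,
      norm_pow_add_pow_eq (hone N)] using this
  have hk' : ∏ j ∈ (Finset.range N).erase k, ‖η k - η j‖
      = 2 ^ p * ∏ i ∈ (binaryDigitPositions N).erase p, ‖(η k / η N) ^ 2 ^ i + 1‖ := by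
    have h1 := Lagrange.eval_nodal_derivative_eval_node_eq (v := η) (Finset.mem_range.2 hk)
    -- The factor at p vanishes at `η k`, so only the term differentiating it survives.
    rw [hnodal, ← Finset.mul_prod_erase _ _ hpB, derivative_mul, eval_add, eval_mul, eval_mul] at h1
    simp only [derivative_add, derivative_X_pow, derivative_C, add_zero, eval_mul, eval_add,
      eval_pow, eval_X, eval_C, hkp, neg_add_cancel, zero_mul, Lagrange.eval_nodal,
      eval_prod] at h1
    have h2 := congrArg norm h1
    simp only [norm_mul, norm_prod, norm_pow, hone, one_pow, mul_one,
      norm_pow_add_pow_eq (hone N)] at h2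
    rw [← h2]
    simp
  have hxy : ‖z / η N - η k / η N‖ = ‖z - η k‖ := by
    rw [← sub_div, norm_div, hone, div_one]
  have := prod_norm_pow_add_one_le (x := z / η N) (y := η k / η N)
    (by rw [norm_div, hone, div_one]; exact hz) (by rw [norm_div, hone, hone, div_one])
    (p := p) (by rw [div_pow, hkp, neg_div, div_self (pow_ne_zero _ he0)]) hpB
  rwa [hxy, ← hk', ← hz'] at this

theorem theorem1 (η : ℕ → ℂ) (hη : IsLejaSequence (Metric.closedBall (0 : ℂ) 1) η)
    (N k : ℕ) (hk : k < N) (z : ℂ) (hz : z ∈ Metric.closedBall (0 : ℂ) 1) :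
    ‖(fundamentalLagrange η N k).eval z‖ ≤ Real.pi * Real.exp (3 * Real.pi) := by
  have hpi := Real.pi_gt_three
  have hinj := hη.injective infinite_closedBall_zero_one
  have hkN : k ∈ Finset.range N := Finset.mem_range.2 hk
  have hE : 2 * Real.exp 2 ≤ Real.pi * Real.exp (3 * Real.pi) := by
    gcongr <;> linarith
  have hE1 : 1 ≤ 2 * Real.exp 2 := by linarith [Real.one_le_exp (x := 2) (by norm_num)]
  refine le_trans ?_ hE
  rw [fundamentalLagrange]
  rcases eq_or_ne z (η k) with rfl | hne
  · rwa [Lagrange.eval_basis_self hinj.injOn hkN, norm_one]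
  have hmain := hη.prod_norm_sub_le hk (mem_closedBall_zero_iff.1 hz)
  have hzk : 0 < ‖z - η k‖ := norm_pos_iff.2 (sub_ne_zero.2 hne)
  have hden : 0 < ∏ j ∈ (Finset.range N).erase k, ‖η k - η j‖ :=
    Finset.prod_pos fun j hj => norm_pos_iff.2
      (sub_ne_zero.2 fun he => Finset.ne_of_mem_erase hj (hinj he).symm)
  rw [← Finset.mul_prod_erase _ _ hkN, mul_left_comm] at hmain
  have hmain := le_of_mul_le_mul_left hmain hzk
  have heval : ‖(Lagrange.basis (Finset.range N) η k).eval z‖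
      = (∏ j ∈ (Finset.range N).erase k, ‖z - η j‖) /
        ∏ j ∈ (Finset.range N).erase k, ‖η k - η j‖ := by
    rw [Lagrange.basis, eval_prod, norm_prod, ← Finset.prod_div_distrib]
    refine Finset.prod_congr rfl fun j _ => ?_
    simp only [Lagrange.basisDivisor, eval_mul, eval_C, eval_sub, eval_X, norm_mul, norm_inv]
    rw [mul_comm, div_eq_mul_inv]
  rw [heval, div_le_iff₀ hden]
  exact hmain
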